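/- Let $M$ be a loopless matroid of rank $d\ge 3$ on a finite ground set. Let $f_{i-1}(M)$ be the number of independent sets of $M$ with exactly $i$ elements, and define the $h$-vector $h(M)=(h_0(M),\dots,h_d(M))$ by $$\sum_{j=0}^d h_j(M)\lambda^j=\sum_{i=0}^d f_{i-1}(M)\lambda^i(1-\lambda)^{d-i}.$$ An order ideal is a finite family of monomials, in finitely many variables, that contains every divisor of each of its members; it is pure if all of its maximal monomials under divisibility have the same degree. A vector $(h_0,\dots,h_r)$ is a pure $O$-sequence if there is a pure order ideal, all of whose monomials have degree at most $r$, that contains exactly $h_i$ monomials of degree $i$ for each $0\le i\le r$. (The maximal monomials may have degree less than $r$, so trailing zeros are allowed.) Then the vector $(1,h_1(M),h_2(M),h_3(M))$ is a pure $O$-sequence. In particular, if $d=3$, then $h(M)$ is a pure $O$-sequence, which is Stanley's conjecture for loopless matroids of rank $3$. -/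

import Mathlib

open Polynomial

noncomputable section

namespace Matroid

variable {α : Type*}

/-- The number `f_{i-1}(M)` of independent sets of `M` with exactly `i` elements. -/
def numIndep (M : Matroid α) (i : ℕ) : ℕ :=
  {A : Set α | M.Indep A ∧ A.encard = i}.ncard

/-- The rank of a matroid of finite rank, as a natural number. -/
def natRank (M : Matroid α) : ℕ := M.eRank.toNat

/-- The `h`-polynomial `∑_{i=0}^d f_{i-1}(M) λ^i (1-λ)^{d-i}` of a matroid `M` of rank `d`. -/
def hPoly (M : Matroid α) : ℤ[X] :=
  ∑ i ∈ Finset.range (M.natRank + 1),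
    C (M.numIndep i : ℤ) * X ^ i * (1 - X) ^ (M.natRank - i)

/-- The number `h_j(M)`: the coefficient of `λ^j` in the `h`-polynomial. -/
def hNumber (M : Matroid α) (j : ℕ) : ℤ := M.hPoly.coeff j

/-- The `h`-vector `(h_0(M), …, h_d(M))` of a matroid `M` of rank `d`. -/
def hVector (M : Matroid α) : Fin (M.natRank + 1) → ℤ := fun j => M.hNumber j

end Matroid

/-- A finite family of monomials, written as exponent vectors (so that divisibility is `≤`), is an
order ideal if it contains every divisor of each of its members. -/
def IsOrderIdeal {σ : Type*} (O : Finset (σ →₀ ℕ)) : Prop :=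
  ∀ μ ∈ O, ∀ ν : σ →₀ ℕ, ν ≤ μ → ν ∈ O

/-- All members of `O` that are maximal under divisibility have the same degree. -/
def IsPureFamily {σ : Type*} (O : Finset (σ →₀ ℕ)) : Prop :=
  ∀ μ ν : σ →₀ ℕ, Maximal (· ∈ O) μ → Maximal (· ∈ O) ν → μ.degree = ν.degree

/-- The vector `(h_0, …, h_r)` is a pure `O`-sequence: for some pure order ideal of monomials of
degree at most `r` in finitely many variables, `h_i` is the number of its monomials of degree `i`.
The degree of the maximal monomials may be smaller than `r`, so trailing zeros are allowed. -/
def IsPureOSequence {r : ℕ} (h : Fin (r + 1) → ℤ) : Prop :=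
  ∃ (n : ℕ) (O : Finset (Fin n →₀ ℕ)),
    IsOrderIdeal O ∧ IsPureFamily O ∧ (∀ μ ∈ O, μ.degree ≤ r) ∧
      ∀ i : Fin (r + 1), h i = ((O.filter fun μ => μ.degree = (i : ℕ)).card : ℤ)

end

/-! Fix a base `B` and give each element `e i` outside `B` a variable `x_i`. Split an independent
set as `S ∪ T` with `S` outside `B` and `T ⊆ B`. For fixed independent `S`, the sets `T` are the
independent sets of `(M/S)|B`, of rank `d - |S|`, so the `h`-polynomial of `M` is the sum over `S`
of `λ^|S|` times that of `(M/S)|B`. The empty `S` gives `1`. A singleton `{e i}` leaves exactly one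
circuit, of size `k_i = #(M.fundSupport B (e i))`, and gives `λ + … + λ^{k_i}`. A pair spanning `t`
elements of `B` gives `λ² + (2 - t)λ³ + …`, and a triple gives `λ³ + …`. The formal proof reaches
the same totals up to degree three by direct counting, in `IsBase.card_hIdeal_filter_degree`.

These terms are realised by the powers `x_i^n` with `n ≤ k_i`, by squarefree monomials on
independent sets, and, for each independent pair, by exactly `2 - t` of the monomials `x_i² x_j` and
`x_i x_j²`. Only `t = 1` leaves a choice: `SquareRel` squares the variable with the smaller `k`
among those with `k ≥ 2`, breaking ties by index.

That choice is what makes the ideal pure. A member of degree one or two with no proper multiple in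
the ideal forces every `e i` into the closure of one, respectively two, elements of `B`; the ideal
then has no members of the next degree. The delicate case is `x_i²` with `k_i = 2`, settled by
`IsBase.card_fundSupport_ne_two`. -/

noncomputable section

/-! ### Order ideals of monomials of degree at most three, counted by degree. -/

section MonomialIdeal

open Finset Classical

variable {ι : Type*}

/-- The squarefree monomial with support `S`. -/
def squarefreeMonomial (S : Finset ι) : ι →₀ ℕ := Finsupp.indicator S fun _ _ => 1

lemma squarefreeMonomial_apply (S : Finset ι) (i : ι) :
    squarefreeMonomial S i = if i ∈ S then 1 else 0 := by
  simp [squarefreeMonomial, Finsupp.indicator_apply]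

lemma support_squarefreeMonomial (S : Finset ι) : (squarefreeMonomial S).support = S := by
  ext i; simp [squarefreeMonomial_apply]

lemma support_squarefreeMonomial_add_single {S : Finset ι} {i : ι} (hi : i ∈ S) :
    (squarefreeMonomial S + Finsupp.single i 1).support = S := by
  ext j
  by_cases hj : i = j
  · subst hj; simp [squarefreeMonomial_apply, hi]
  · simp [squarefreeMonomial_apply, hj]

lemma degree_squarefreeMonomial (S : Finset ι) : (squarefreeMonomial S).degree = #S := by
  rw [Finsupp.degree_apply, support_squarefreeMonomial]
  simp [squarefreeMonomial_apply]

lemma lt_of_le_of_degree_lt {μ ν : ι →₀ ℕ} (h : μ ≤ ν) (hd : μ.degree < ν.degree) :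
    μ < ν :=
  lt_of_le_of_ne h (by rintro rfl; exact hd.false)

lemma squarefreeMonomial_insert [DecidableEq ι] {S : Finset ι} {j : ι} (hj : j ∉ S) :
    squarefreeMonomial (insert j S) = squarefreeMonomial S + Finsupp.single j 1 := by
  ext i
  simp only [squarefreeMonomial_apply, Finsupp.add_apply, Finsupp.single_apply, mem_insert]
  by_cases h : j = i
  · subst h; simp [hj]
  · simp [h, Ne.symm h]

lemma squarefreeMonomial_singleton (i : ι) :
    squarefreeMonomial {i} = Finsupp.single i 1 := by
  ext j
  simp [squarefreeMonomial_apply, Finsupp.single_apply, eq_comm]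

lemma squarefreeMonomial_support_le (μ : ι →₀ ℕ) : squarefreeMonomial μ.support ≤ μ := by
  intro i
  rw [squarefreeMonomial_apply]
  split_ifs with h
  · exact Nat.one_le_iff_ne_zero.2 (Finsupp.mem_support_iff.1 h)
  · exact Nat.zero_le _

lemma card_support_le_degree (μ : ι →₀ ℕ) : #μ.support ≤ μ.degree := by
  rw [← degree_squarefreeMonomial]
  exact Finsupp.degree_mono (squarefreeMonomial_support_le μ)

lemma exists_degree_eq_add {μ : ι →₀ ℕ} :
    ∃ ν : ι →₀ ℕ, μ = squarefreeMonomial μ.support + ν ∧ μ.degree = #μ.support + ν.degree := by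
  refine ⟨μ - squarefreeMonomial μ.support, ?_, ?_⟩
  · rw [add_tsub_cancel_of_le (squarefreeMonomial_support_le μ)]
  · conv_lhs => rw [← add_tsub_cancel_of_le (squarefreeMonomial_support_le μ)]
    rw [map_add, degree_squarefreeMonomial]

lemma eq_squarefreeMonomial {μ : ι →₀ ℕ} (h : μ.degree = #μ.support) :
    μ = squarefreeMonomial μ.support := by
  obtain ⟨ν, h1, h2⟩ := exists_degree_eq_add (μ := μ)
  have h3 : ν = 0 := (Finsupp.degree_eq_zero_iff ν).1 (by omega)
  simpa [h3] using h1

lemma eq_squarefreeMonomial_add_single {μ : ι →₀ ℕ} (h : μ.degree = #μ.support + 1) :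
    ∃ i ∈ μ.support, μ = squarefreeMonomial μ.support + Finsupp.single i 1 := by
  obtain ⟨ν, h1, h2⟩ := exists_degree_eq_add (μ := μ)
  have h3 : ν.degree = 1 := by omega
  have h4 : ν ∈ Set.range fun i : ι => Finsupp.single i 1 := by
    rw [Finsupp.range_single_one]; exact h3
  obtain ⟨i, rfl⟩ := h4
  refine ⟨i, ?_, h1⟩
  rw [h1]
  simp

lemma support_nonempty_of_degree_ne_zero {μ : ι →₀ ℕ} (h : μ.degree ≠ 0) : 0 < #μ.support := by
  rw [card_pos, Finsupp.support_nonempty_iff]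
  rintro rfl
  simp at h

/-- `W i j` holds for all `j ∈ S` other than `i`. -/
def SquareAllowed (W : ι → ι → Prop) (S : Finset ι) (i : ι) : Prop := ∀ j ∈ S, i ≠ j → W i j

variable [Fintype ι] (I : Finset ι → Prop) (k : ι → ℕ) (W : ι → ι → Prop)

/-- The monomials of degree at most three whose support satisfies `I`, whose exponents are bounded
by `k`, and which are divisible by `x_i ^ 2 * x_j` with `i ≠ j` only if `W i j`. -/
def cubicIdeal : Finset (ι →₀ ℕ) :=
  (Finsupp.finite_of_degree_le (σ := ι) 3).toFinset.filter fun μ =>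
    I μ.support ∧ (∀ i, μ i ≤ k i) ∧ ∀ i j, i ≠ j → 2 ≤ μ i → j ∈ μ.support → W i j

variable {I k W}

lemma mem_cubicIdeal {μ : ι →₀ ℕ} : μ ∈ cubicIdeal I k W ↔ μ.degree ≤ 3 ∧ I μ.support ∧
    (∀ i, μ i ≤ k i) ∧ ∀ i j, i ≠ j → 2 ≤ μ i → j ∈ μ.support → W i j := by
  simp [cubicIdeal]

lemma isOrderIdeal_cubicIdeal (hI : ∀ S T, S ⊆ T → I T → I S) :
    IsOrderIdeal (cubicIdeal I k W) := by
  intro μ hμ ν hν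
  rw [mem_cubicIdeal] at hμ ⊢
  obtain ⟨h1, h2, h3, h4⟩ := hμ
  have hs : ν.support ⊆ μ.support := Finsupp.support_mono hν
  exact ⟨(Finsupp.degree_mono hν).trans h1, hI _ _ hs h2, fun i => (hν i).trans (h3 i),
    fun i j hij hi hj => h4 i j hij (hi.trans (hν i)) (hs hj)⟩

lemma squarefreeMonomial_mem_cubicIdeal (hk : ∀ i, 1 ≤ k i) {S : Finset ι} (hS : I S)
    (hc : #S ≤ 3) : squarefreeMonomial S ∈ cubicIdeal I k W := by
  rw [mem_cubicIdeal, degree_squarefreeMonomial, support_squarefreeMonomial]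
  refine ⟨hc, hS, fun i => ?_, fun i j _ hi => ?_⟩
  · rw [squarefreeMonomial_apply]; split_ifs <;> simp [hk]
  · rw [squarefreeMonomial_apply] at hi; split_ifs at hi <;> omega

lemma single_mem_cubicIdeal {i : ι} (hI : I {i}) {n : ℕ} (hn : n ≤ 3) (hn0 : n ≠ 0)
    (hi : n ≤ k i) : Finsupp.single i n ∈ cubicIdeal I k W := by
  rw [mem_cubicIdeal, Finsupp.degree_single, Finsupp.support_single _ hn0]
  refine ⟨hn, hI, fun j => ?_, fun a b hab ha hb => ?_⟩
  · rw [Finsupp.single_apply]; split_ifs with h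
    · exact h ▸ hi
    · exact Nat.zero_le _
  · rw [mem_singleton] at hb
    rw [Finsupp.single_apply, if_neg (by rintro rfl; exact hab hb.symm)] at ha
    omega

lemma squarefreeMonomial_add_single_mem_cubicIdeal (hk : ∀ i, 1 ≤ k i) {S : Finset ι} (hS : I S)
    (hc : #S = 2) {i : ι} (hi : i ∈ S) (hki : 2 ≤ k i) (hW : SquareAllowed W S i) :
    squarefreeMonomial S + Finsupp.single i 1 ∈ cubicIdeal I k W := by
  rw [mem_cubicIdeal, support_squarefreeMonomial_add_single hi]
  simp only [map_add, degree_squarefreeMonomial, Finsupp.degree_single, hc]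
  refine ⟨by norm_num, hS, fun j => ?_, fun a b hab ha hb => ?_⟩
  · simp only [Finsupp.add_apply, squarefreeMonomial_apply, Finsupp.single_apply]
    have := hk j
    split_ifs with h1 h2 h2
    · subst h2; omega
    · omega
    · subst h2; omega
    · omega
  · simp only [Finsupp.add_apply, squarefreeMonomial_apply, Finsupp.single_apply] at ha
    -- Only the exponent of `x_i` reaches two, so the condition on squares concerns `a = i` alone.
    have : i = a := by
      by_contra h
      rw [if_neg h] at ha
      split_ifs at ha <;> omega
    subst this
    exact hW b hb hab

lemma card_squarefree_cubicIdeal (hk : ∀ i, 1 ≤ k i) {n : ℕ} (hn : n ≤ 3) :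
    #{μ ∈ cubicIdeal I k W | μ.degree = n ∧ #μ.support = n} =
      #{S ∈ powersetCard n (univ : Finset ι) | I S} := by
  refine Finset.card_bij' (fun μ _ => μ.support) (fun S _ => squarefreeMonomial S) ?_ ?_ ?_ ?_
  · intro μ hμ
    simp only [mem_filter, mem_cubicIdeal, mem_powersetCard] at hμ ⊢
    exact ⟨⟨subset_univ _, hμ.2.2⟩, hμ.1.2.1⟩
  · intro S hS
    simp only [mem_filter, mem_powersetCard, degree_squarefreeMonomial,
      support_squarefreeMonomial] at hS ⊢
    exact ⟨squarefreeMonomial_mem_cubicIdeal hk hS.2 (by omega), hS.1.2, hS.1.2⟩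
  · intro μ hμ
    simp only [mem_filter] at hμ
    exact (eq_squarefreeMonomial (hμ.2.1.trans hμ.2.2.symm)).symm
  · intro S _
    exact support_squarefreeMonomial S

lemma card_pure_power_cubicIdeal (hI : ∀ i, I {i}) {n : ℕ} (hn : n ≤ 3) (hn0 : n ≠ 0) :
    #{μ ∈ cubicIdeal I k W | μ.degree = n ∧ #μ.support = 1} = #{i | n ≤ k i} := by
  symm
  refine Finset.card_bij (fun i _ => Finsupp.single i n) ?_ ?_ ?_
  · intro i hi
    simp only [mem_filter, mem_univ, true_and, Finsupp.degree_single,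
      Finsupp.support_single _ hn0, card_singleton, and_true] at hi ⊢
    exact single_mem_cubicIdeal (hI i) hn hn0 hi
  · intro i _ j _ h
    exact Finsupp.single_left_injective hn0 h
  · intro μ hμ
    simp only [mem_filter, mem_cubicIdeal] at hμ
    obtain ⟨i, hi⟩ := card_eq_one.1 hμ.2.2
    have h1 : μ = Finsupp.single i (μ i) := Finsupp.support_subset_singleton.1 hi.subset
    have h2 : μ i = n := by rw [← hμ.2.1, h1]; simp
    refine ⟨i, ?_, by rw [← h2, ← h1]⟩
    simpa [← h2] using hμ.1.2.2.1 i

/-- Fibre over the support: a cubic monomial with two-element support `S` is the squarefree monomial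
of `S` times one `x_i` with `i ∈ S`. The hypothesis `hW` makes the exponent bound automatic. -/
lemma card_square_mul_cubicIdeal (hk : ∀ i, 1 ≤ k i) (hW : ∀ i j, W i j → 2 ≤ k i) :
    #{μ ∈ cubicIdeal I k W | μ.degree = 3 ∧ #μ.support = 2} =
      ∑ S ∈ powersetCard 2 (univ : Finset ι) with I S, #{i ∈ S | SquareAllowed W S i} := by
  rw [card_eq_sum_card_fiberwise (f := Finsupp.support)
    (t := {S ∈ powersetCard 2 (univ : Finset ι) | I S})]
  · refine sum_congr rfl fun S hS => ?_
    simp only [mem_filter, mem_powersetCard, subset_univ, true_and] at hS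
    symm
    refine Finset.card_bij (fun i _ => squarefreeMonomial S + Finsupp.single i 1) ?_ ?_ ?_
    · intro i hi
      simp only [mem_filter] at hi
      obtain ⟨l, hl⟩ : (S.erase i).Nonempty := by
        rw [← card_pos, card_erase_of_mem hi.1]; omega
      have hki := hW i l (hi.2 l (mem_of_mem_erase hl) (ne_of_mem_erase hl).symm)
      simp only [mem_filter, support_squarefreeMonomial_add_single hi.1, map_add,
        degree_squarefreeMonomial, Finsupp.degree_single, hS.1, and_true]
      exact squarefreeMonomial_add_single_mem_cubicIdeal hk hS.2 hS.1 hi.1 hki hi.2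
    · intro i _ j _ h
      exact Finsupp.single_left_injective one_ne_zero (add_left_cancel h)
    · intro μ hμ
      simp only [mem_filter, mem_cubicIdeal] at hμ
      obtain ⟨⟨⟨-, -, -, h4⟩, h5, h6⟩, rfl⟩ := hμ
      obtain ⟨i, hi, h⟩ := eq_squarefreeMonomial_add_single (μ := μ) (by omega)
      refine ⟨i, mem_filter.2 ⟨hi, fun j hj hij => h4 i j hij ?_ hj⟩, h.symm⟩
      rw [h]
      simp only [Finsupp.add_apply, squarefreeMonomial_apply, if_pos hi, Finsupp.single_eq_same]
      norm_num
  · intro μ hμ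
    simp only [coe_filter, mem_cubicIdeal, Set.mem_ofPred_eq, mem_powersetCard] at hμ ⊢
    exact ⟨⟨subset_univ _, hμ.2.2⟩, hμ.1.2.1⟩

lemma card_degree_zero_cubicIdeal (hI : I ∅) (hk : ∀ i, 1 ≤ k i) :
    #{μ ∈ cubicIdeal I k W | μ.degree = 0} = 1 := by
  have h := card_squarefree_cubicIdeal (I := I) (W := W) hk (n := 0) (by norm_num)
  rw [powersetCard_zero, filter_singleton, if_pos hI, card_singleton] at h
  rw [← h]
  congr 1
  refine filter_congr fun μ _ => ⟨fun h => ⟨h, ?_⟩, fun h => h.1⟩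
  have := card_support_le_degree μ
  omega

lemma card_degree_one_cubicIdeal (hI : ∀ i, I {i}) (hk : ∀ i, 1 ≤ k i) :
    #{μ ∈ cubicIdeal I k W | μ.degree = 1} = Fintype.card ι := by
  have h := card_pure_power_cubicIdeal (I := I) (k := k) (W := W) hI (n := 1) (by norm_num)
    (by norm_num)
  rw [filter_true_of_mem (s := univ) (fun i _ => hk i), card_univ] at h
  rw [← h]
  congr 1
  refine filter_congr fun μ _ => ⟨fun h => ⟨h, ?_⟩, fun h => h.1⟩
  have := card_support_le_degree μ
  have := support_nonempty_of_degree_ne_zero (μ := μ) (by omega)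
  omega

lemma card_degree_two_cubicIdeal (hI : ∀ i, I {i}) (hk : ∀ i, 1 ≤ k i) :
    #{μ ∈ cubicIdeal I k W | μ.degree = 2} =
      #{S ∈ powersetCard 2 (univ : Finset ι) | I S} + #{i | 2 ≤ k i} := by
  rw [← card_pure_power_cubicIdeal (I := I) (k := k) (W := W) hI (n := 2) (by norm_num)
    (by norm_num), ← card_squarefree_cubicIdeal (I := I) (W := W) hk (n := 2) (by norm_num),
    ← card_union_of_disjoint]
  · congr 1
    ext μ
    simp only [mem_filter, mem_union]
    have := card_support_le_degree μ
    constructor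
    · rintro ⟨h1, h2⟩
      have := support_nonempty_of_degree_ne_zero (μ := μ) (by omega)
      have : #μ.support = 2 ∨ #μ.support = 1 := by omega
      tauto
    · tauto
  · rw [disjoint_filter]
    intro μ _ h1 h2
    omega

/-- The three summands correspond to supports of size three, two and one. -/
lemma card_degree_three_cubicIdeal (hI : ∀ i, I {i}) (hk : ∀ i, 1 ≤ k i)
    (hW : ∀ i j, W i j → 2 ≤ k i) :
    #{μ ∈ cubicIdeal I k W | μ.degree = 3} =
      #{S ∈ powersetCard 3 (univ : Finset ι) | I S} +
      (∑ S ∈ powersetCard 2 (univ : Finset ι) with I S, #{i ∈ S | SquareAllowed W S i}) +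
      #{i | 3 ≤ k i} := by
  rw [← card_pure_power_cubicIdeal (I := I) (k := k) (W := W) hI (n := 3) (by norm_num)
    (by norm_num), ← card_squarefree_cubicIdeal (I := I) (W := W) hk (n := 3) (by norm_num),
    ← card_square_mul_cubicIdeal hk hW, ← card_union_of_disjoint, ← card_union_of_disjoint]
  · congr 1
    ext μ
    simp only [mem_filter, mem_union]
    have := card_support_le_degree μ
    constructor
    · rintro ⟨h1, h2⟩
      have := support_nonempty_of_degree_ne_zero (μ := μ) (by omega)
      have : #μ.support = 3 ∨ #μ.support = 2 ∨ #μ.support = 1 := by omega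
      tauto
    · tauto
  · rw [disjoint_left]
    simp only [mem_filter, mem_union]
    intro μ h1 h2
    omega
  · rw [disjoint_filter]
    intro μ _ h1 h2
    omega

end MonomialIdeal

/-- An order ideal is pure if a member that does not have the largest degree is never maximal. -/
lemma IsOrderIdeal.isPureFamily {σ : Type*} {O : Finset (σ →₀ ℕ)} (hO : IsOrderIdeal O)
    (h : ∀ μ ∈ O, ∀ ν ∈ O, ν.degree = μ.degree + 1 → ∃ ρ ∈ O, μ < ρ) : IsPureFamily O := by
  have key : ∀ μ ν : σ →₀ ℕ, Maximal (· ∈ O) μ → ν ∈ O → ν.degree ≤ μ.degree := by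
    intro μ ν hμ hν
    by_contra! hlt
    -- A divisor of `ν` exactly one degree above `μ` suffices for `h`.
    obtain ⟨ν', hν', hd⟩ := Finsupp.exists_le_degree_eq ν (μ.degree + 1) hlt
    obtain ⟨ρ, hρ, hlt⟩ := h μ hμ.prop ν' (hO ν hν ν' hν') hd
    exact hlt.not_ge (hμ.le_of_ge hρ hlt.le)
  exact fun μ ν hμ hν => (key ν μ hν hμ.prop).antisymm (key μ ν hμ hν.prop)

end

noncomputable section

lemma Set.encard_pair_le {α : Type*} (x y : α) : ({x, y} : Set α).encard ≤ 2 := by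
  have h := Set.encard_insert_le {y} x
  rwa [Set.encard_singleton, one_add_one_eq_two] at h

/-! ### Closures of one or two elements relative to a base. -/

namespace Matroid

open Finset Classical

variable {α : Type*} {M : Matroid α}

lemma Indep.encard_le_of_subset_closure {X Y : Set α} (hX : M.Indep X) (hXY : X ⊆ M.closure Y) :
    X.encard ≤ Y.encard :=
  (hX.encard_le_eRk_of_subset hXY).trans ((M.eRk_closure_eq Y).le.trans (M.eRk_le_encard Y))

lemma Indep.closure_subset_closure_of_encard_le {X Y : Set α} (hX : M.Indep X) (hfin : X.Finite)
    (hXY : X ⊆ M.closure Y) (hc : Y.encard ≤ X.encard) : M.closure Y ⊆ M.closure X := by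
  have h := (M.isRkFinite_of_finite hfin).closure_eq_closure_of_subset_of_eRk_ge_eRk hXY (by
    rw [M.eRk_closure_eq, hX.eRk_eq_encard]
    exact (M.eRk_le_encard Y).trans hc)
  rw [h, closure_closure]

/-- The elements of `B` other than `x` in the fundamental circuit of `x` with respect to `B`. -/
def fundSupport (M : Matroid α) (B : Finset α) (x : α) : Finset α :=
  {b ∈ B | x ∉ M.closure (B \ {b})}

/-- The elements of `B` spanned by `Z`. -/
def closureTrace (M : Matroid α) (B : Finset α) (Z : Set α) : Finset α := {b ∈ B | b ∈ M.closure Z}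

variable {B : Finset α} {x y : α}

lemma fundSupport_subset : M.fundSupport B x ⊆ B := filter_subset _ _

lemma closureTrace_subset {Z : Set α} : M.closureTrace B Z ⊆ B := filter_subset _ _

lemma mem_closureTrace {Z : Set α} {b : α} :
    b ∈ M.closureTrace B Z ↔ b ∈ B ∧ b ∈ M.closure Z := mem_filter

/-- A proper subset `S` of `B` is the intersection of the sets `B \ {b}` with `b ∈ B \ S`, and
closure commutes with intersections of subsets of an independent set. -/
lemma IsBase.mem_closure_iff_fundSupport_subset (hB : M.IsBase B) (hx : x ∈ M.E) {S : Finset α}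
    (hS : S ⊆ B) : x ∈ M.closure S ↔ M.fundSupport B x ⊆ S := by
  constructor
  · intro h b hb
    rw [fundSupport, mem_filter] at hb
    by_contra hbS
    exact hb.2 (M.closure_subset_closure (Set.subset_sdiff_singleton (coe_subset.2 hS) hbS) h)
  · intro h
    obtain hne | hne := ((B : Set α) \ S).eq_empty_or_nonempty
    · have : S = B := hS.antisymm (by simpa [Set.sdiff_eq_empty] using hne)
      rw [this, hB.closure_eq]
      exact hx
    · have hU : M.Indep (⋃ b ∈ (B : Set α) \ S, (B : Set α) \ {b}) :=
        hB.indep.subset (Set.iUnion₂_subset fun _ _ => Set.sdiff_subset)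
      have hSB : (⋂ b ∈ (B : Set α) \ S, (B : Set α) \ {b}) = S := by
        ext s
        simp only [Set.mem_iInter, Set.mem_sdiff, Set.mem_singleton_iff, mem_coe]
        constructor
        · intro h
          by_contra hs
          obtain ⟨c, hc⟩ := hne
          exact (h s ⟨(h c hc).1, hs⟩).2 rfl
        · rintro hs b hb
          exact ⟨hS hs, by rintro rfl; exact hb.2 hs⟩
      have hcl := closure_biInter_eq_biInter_closure_of_biUnion_indep hne hU
      rw [hSB] at hcl
      rw [hcl, Set.mem_iInter₂]
      intro b hb
      by_contra hxb
      exact hb.2 (h (mem_filter.2 ⟨hb.1, hxb⟩))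

lemma IsBase.mem_closure_fundSupport (hB : M.IsBase B) (hx : x ∈ M.E) :
    x ∈ M.closure (M.fundSupport B x) :=
  (hB.mem_closure_iff_fundSupport_subset hx fundSupport_subset).2 Subset.rfl

lemma IsBase.one_le_card_fundSupport [M.Loopless] (hB : M.IsBase B) (hx : x ∈ M.E) :
    1 ≤ #(M.fundSupport B x) := by
  rw [Nat.one_le_iff_ne_zero, Ne, card_eq_zero]
  intro h
  have := hB.mem_closure_fundSupport hx
  rw [h] at this
  simp [closure_empty] at this

lemma mem_closure_singleton_comm [M.Loopless] (h : x ∈ M.closure {y}) : y ∈ M.closure {x} := by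
  have := (M.closure_exchange (X := ∅) (e := x) (f := y) (by simpa [closure_empty, M.loops_eq_empty] using h)).1
  simpa using this

/-- Here `x` is parallel to `b`, so every set spanning `x` spans `b`. -/
lemma IsBase.closureTrace_of_fundSupport_eq [M.Loopless] (hB : M.IsBase B) (hx : x ∈ M.E) {b : α}
    (h : M.fundSupport B x = {b}) {Z : Set α} (hxZ : x ∈ M.closure Z) :
    b ∈ M.closureTrace B Z := by
  have hb := hB.mem_closure_fundSupport hx
  rw [h, coe_singleton] at hb
  refine mem_closureTrace.2 ⟨fundSupport_subset (h ▸ mem_singleton_self b), ?_⟩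
  exact M.closure_subset_closure_of_subset_closure (Set.singleton_subset_iff.2 hxZ)
    (mem_closure_singleton_comm hb)

lemma IsBase.card_closureTrace_pair_le (hB : M.IsBase B) : #(M.closureTrace B {x, y}) ≤ 2 := by
  have h := (hB.indep.subset (coe_subset.2 (closureTrace_subset (Z := {x, y})))).encard_le_of_subset_closure
    (fun b hb => (mem_closureTrace.1 hb).2)
  have h2 := h.trans (Set.encard_pair_le x y)
  rw [Set.encard_coe_eq_coe_finsetCard] at h2
  exact_mod_cast h2

lemma IsBase.closure_pair_subset (hB : M.IsBase B) {S : Finset α}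
    (hS : S ⊆ M.closureTrace B {x, y}) (hc : #S = 2) : M.closure {x, y} ⊆ M.closure S := by
  refine (hB.indep.subset (coe_subset.2 (hS.trans closureTrace_subset)))
    |>.closure_subset_closure_of_encard_le S.finite_toSet
      (fun b hb => (mem_closureTrace.1 (hS hb)).2) ?_
  rw [Set.encard_coe_eq_coe_finsetCard, hc]
  exact Set.encard_pair_le x y

/-- Two elements of `B` spanned by `{x, y}` would span `x` and `y`; they would then be the
fundamental support of `x`, whose closure misses `y`. -/
lemma IsBase.card_closureTrace_pair_le_one (hB : M.IsBase B) (hx : x ∈ M.E)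
    (hcx : #(M.fundSupport B x) = 2) (hxy : x ∈ M.closure {x, y}) (hyx : y ∈ M.closure {x, y})
    (hy : y ∉ M.closure (M.fundSupport B x)) : #(M.closureTrace B {x, y}) ≤ 1 := by
  by_contra! h
  obtain ⟨S, hS, hc⟩ := exists_subset_card_eq (Nat.succ_le_of_lt h)
  have hcl := hB.closure_pair_subset hS hc
  have hsub := (hB.mem_closure_iff_fundSupport_subset hx (hS.trans closureTrace_subset)).1 (hcl hxy)
  rw [eq_of_subset_of_card_le hsub (by omega)] at hy
  exact hy (hcl hyx)

/-- Let `β` be the one element of `B` spanned by `{x, y}`. Exchange puts `y` in the span of `β` and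
`x`, so the support of `y` contains `β`. If it were `{β, b}`, exchanging again would put `b` in the
span of `{x, y}`, a second element of `B`. -/
lemma IsBase.card_fundSupport_ne_two [M.Loopless] (hB : M.IsBase B) (hx : x ∈ M.E) (hyE : y ∈ M.E)
    (hcx : #(M.fundSupport B x) = 2) (hy : y ∉ M.closure (M.fundSupport B x))
    (ht : #(M.closureTrace B {x, y}) = 1) : #(M.fundSupport B y) ≠ 2 := by
  intro hcy
  obtain ⟨β, hβ⟩ := card_eq_one.1 ht
  have hβ' := mem_closureTrace.1 (hβ ▸ mem_singleton_self β : β ∈ M.closureTrace B {x, y})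
  -- An element with support of size two is not parallel to `β`; this licenses both exchanges below.
  have hnot : ∀ z ∈ M.E, #(M.fundSupport B z) = 2 → z ∉ M.closure {β} := by
    intro z hz hcz h
    have := (hB.mem_closure_iff_fundSupport_subset hz (singleton_subset_iff.2 hβ'.1)).1
      (by simpa using h)
    have := card_le_card this
    rw [card_singleton] at this
    omega
  have hβE := hB.subset_ground hβ'.1
  have hyβ : y ∈ M.closure {β, x} := (M.closure_exchange (X := {x}) (e := β) (f := y)
    ⟨by rw [Set.pair_comm]; exact hβ'.2,
      fun h => hnot x hx hcx (mem_closure_singleton_comm h)⟩).1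
  have hsub : M.fundSupport B y ⊆ insert β (M.fundSupport B x) := by
    rw [← hB.mem_closure_iff_fundSupport_subset hyE
      (insert_subset hβ'.1 fundSupport_subset)]
    refine M.closure_subset_closure_of_subset_closure ?_ hyβ
    rw [coe_insert, Set.insert_subset_iff, Set.singleton_subset_iff]
    refine ⟨M.mem_closure_of_mem' (Set.mem_insert _ _) hβE, ?_⟩
    exact M.closure_subset_closure (Set.subset_insert _ _) (hB.mem_closure_fundSupport hx)
  rw [hB.mem_closure_iff_fundSupport_subset hyE fundSupport_subset] at hy
  have hβy : β ∈ M.fundSupport B y := by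
    by_contra h
    exact hy fun b hb => (mem_insert.1 (hsub hb)).resolve_left (by rintro rfl; exact h hb)
  obtain ⟨b, hb⟩ := card_eq_one.1 (by rw [card_erase_of_mem hβy, hcy] :
    #((M.fundSupport B y).erase β) = 1)
  have hby : M.fundSupport B y = {β, b} := by rw [← insert_erase hβy, hb]
  have hbβ : b ≠ β := ne_of_mem_erase (hb ▸ mem_singleton_self b)
  have hycl := hB.mem_closure_fundSupport hyE
  rw [hby, coe_insert, coe_singleton] at hycl
  have hbcl : b ∈ M.closure {y, β} := (M.closure_exchange (X := {β}) (e := y) (f := b)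
    ⟨by rw [Set.pair_comm]; exact hycl, hnot y hyE hcy⟩).1
  have hbt : b ∈ M.closureTrace B {x, y} := by
    refine mem_closureTrace.2 ⟨fundSupport_subset (by rw [hby]; simp : b ∈ M.fundSupport B y), ?_⟩
    refine M.closure_subset_closure_of_subset_closure ?_ hbcl
    rw [Set.insert_subset_iff, Set.singleton_subset_iff]
    exact ⟨M.mem_closure_of_mem' (by simp) hyE, hβ'.2⟩
  rw [hβ, mem_singleton] at hbt
  exact hbβ hbt

end Matroid

end

noncomputable section

/-! ### The order ideal of a matroid with a chosen base, and its purity. -/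

namespace Matroid

open Finset Classical

variable {α : Type*} {M : Matroid α} {B : Finset α} {ι : Type*} {e : ι ↪ α}

lemma indep_image_singleton [M.Loopless] (he : ∀ i, e i ∈ M.E) (i : ι) :
    M.Indep (e '' (({i} : Finset ι) : Set ι)) := by
  rw [coe_singleton, Set.image_singleton, indep_singleton]
  exact M.isNonloop_of_loopless (he i)

variable [LinearOrder ι]

/-- The pairs `(i, j)` for which the monomial `x_i ^ 2 * x_j` is chosen to represent an element of
`B` not spanned by the independent pair `e i, e j`. -/
def SquareRel (M : Matroid α) (B : Finset α) (e : ι ↪ α) (i j : ι) : Prop :=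
  2 ≤ #(M.fundSupport B (e i)) ∧ (#(M.closureTrace B {e i, e j}) = 0 ∨
    #(M.closureTrace B {e i, e j}) = 1 ∧ (#(M.fundSupport B (e j)) = 1 ∨
      #(M.fundSupport B (e i)) < #(M.fundSupport B (e j)) ∨
      #(M.fundSupport B (e i)) = #(M.fundSupport B (e j)) ∧ i < j))

/-- With `t` spanned elements of `B`: if `t = 0` both supports have size at least two and both
squares are allowed; if `t = 1` the supports are not both singletons and the tie-break selects one
square; if `t = 2` none is allowed. -/
lemma IsBase.card_squareRel_add_card_closureTrace [M.Loopless] (hB : M.IsBase B)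
    (he : ∀ i, e i ∈ M.E) {S : Finset ι} (hc : #S = 2) (hS : M.Indep (e '' S)) :
    #{i ∈ S | SquareAllowed (M.SquareRel B e) S i} + #(M.closureTrace B (e '' S)) = 2 := by
  obtain ⟨i, j, hij, rfl⟩ := card_eq_two.1 hc
  have hF : #{a ∈ ({i, j} : Finset ι) | SquareAllowed (M.SquareRel B e) {i, j} a} =
      (if M.SquareRel B e i j then 1 else 0) + (if M.SquareRel B e j i then 1 else 0) := by
    rw [card_filter, sum_pair hij]
    simp [SquareAllowed, hij, hij.symm]
  have himg : e '' (({i, j} : Finset ι) : Set ι) = {e i, e j} := by simp [Set.image_pair]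
  rw [hF, himg]
  rw [himg] at hS
  have hle := hB.card_closureTrace_pair_le (x := e i) (y := e j)
  have hi1 := hB.one_le_card_fundSupport (he i)
  have hj1 := hB.one_le_card_fundSupport (he j)
  have hicl : e i ∈ M.closure {e i, e j} := M.mem_closure_of_mem' (by simp) (he i)
  have hjcl : e j ∈ M.closure {e i, e j} := M.mem_closure_of_mem' (by simp) (he j)
  have hpos : ∀ a, (e a ∈ M.closure {e i, e j}) → #(M.fundSupport B (e a)) = 1 →
      #(M.closureTrace B {e i, e j}) ≠ 0 := by
    intro a ha h1
    obtain ⟨b, hb⟩ := card_eq_one.1 h1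
    exact (card_pos.2 ⟨b, hB.closureTrace_of_fundSupport_eq (he a) hb ha⟩).ne'
  have hi2 := hpos i hicl
  have hj2 := hpos j hjcl
  -- Both elements are parallel to elements of `B`, distinct because the pair is independent.
  have h11 : #(M.fundSupport B (e i)) = 1 → #(M.fundSupport B (e j)) = 1 →
      2 ≤ #(M.closureTrace B {e i, e j}) := by
    intro h1 h2
    obtain ⟨b, hb⟩ := card_eq_one.1 h1
    obtain ⟨c, hc⟩ := card_eq_one.1 h2
    have hbc : b ≠ c := by
      rintro rfl
      have h1 := hB.mem_closure_fundSupport (he i)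
      have h2 := hB.mem_closure_fundSupport (he j)
      rw [hb] at h1
      rw [hc] at h2
      have := hS.encard_le_of_subset_closure (Y := (({b} : Finset α) : Set α))
        (Set.insert_subset h1 (Set.singleton_subset_iff.2 h2))
      rw [Set.encard_pair (e.injective.ne hij), coe_singleton, Set.encard_singleton] at this
      exact absurd this (by decide)
    rw [← card_pair hbc]
    refine card_le_card (insert_subset ?_ (singleton_subset_iff.2 ?_))
    · exact hB.closureTrace_of_fundSupport_eq (he i) hb hicl
    · exact hB.closureTrace_of_fundSupport_eq (he j) hc hjcl
  have hlt := lt_trichotomy i j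
  rw [SquareRel, SquareRel, Set.pair_comm (e j) (e i)]
  have hlt' : (i < j ∧ ¬ j < i) ∨ (j < i ∧ ¬ i < j) := by
    obtain h | h | h := hlt
    · exact .inl ⟨h, h.not_gt⟩
    · exact absurd h hij
    · exact .inr ⟨h, h.not_gt⟩
  -- What remains is arithmetic in the two support sizes and the number of spanned elements.
  generalize #(M.fundSupport B (e i)) = p at *
  generalize #(M.fundSupport B (e j)) = q at *
  generalize #(M.closureTrace B {e i, e j}) = t at *
  obtain ⟨h1, h2⟩ | ⟨h1, h2⟩ := hlt' <;> simp only [h1, h2, and_true, and_false, or_false] <;>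
    split_ifs <;> omega

/-- At most one element of `B` is spanned, and if there is one then the support of `e j` has size
one or at least three. Either way the tie-break favours `i`, with no appeal to the index order. -/
lemma IsBase.squareRel_of_notMem_closure [M.Loopless] (hB : M.IsBase B) (he : ∀ i, e i ∈ M.E)
    {i j : ι} (hci : #(M.fundSupport B (e i)) = 2)
    (hj : e j ∉ M.closure (M.fundSupport B (e i))) : M.SquareRel B e i j := by
  have h1 := hB.card_closureTrace_pair_le_one (he i) hci
    (M.mem_closure_of_mem' (by simp) (he i)) (M.mem_closure_of_mem' (by simp) (he j)) hj
  have h2 := hB.card_fundSupport_ne_two (he i) (he j) hci hj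
  have h3 := hB.one_le_card_fundSupport (he j)
  rw [SquareRel]
  omega

variable [Fintype ι]

/-- An order ideal of monomials whose members of degree at most three are counted by the
`h`-numbers of `M`. -/
def hIdeal (M : Matroid α) (B : Finset α) (e : ι ↪ α) : Finset (ι →₀ ℕ) :=
  cubicIdeal (fun S => M.Indep (e '' S)) (fun i => #(M.fundSupport B (e i))) (M.SquareRel B e)

lemma isOrderIdeal_hIdeal : IsOrderIdeal (M.hIdeal B e) :=
  isOrderIdeal_cubicIdeal fun _ _ hST hT => hT.subset (Set.image_mono (coe_subset.2 hST))

lemma card_support_le_of_mem_hIdeal {μ : ι →₀ ℕ} (hμ : μ ∈ M.hIdeal B e) {L : Finset α}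
    (hL : ∀ i, e i ∈ M.closure L) : #μ.support ≤ #L := by
  have h := (mem_cubicIdeal.1 hμ).2.1.encard_le_of_subset_closure (Y := (L : Set α))
    (by rintro _ ⟨i, -, rfl⟩; exact hL i)
  rw [e.injective.encard_image, Set.encard_coe_eq_coe_finsetCard,
    Set.encard_coe_eq_coe_finsetCard] at h
  exact_mod_cast h

lemma IsBase.degree_ne_two_of_forall_mem_closure (hB : M.IsBase B) (he : ∀ i, e i ∈ M.E)
    {L : Finset α} (hLB : L ⊆ B) (hc : #L = 1) (hL : ∀ i, e i ∈ M.closure L) {ν : ι →₀ ℕ}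
    (hν : ν ∈ M.hIdeal B e) : ν.degree ≠ 2 := by
  intro hd
  have h1 := card_support_le_of_mem_hIdeal hν hL
  have hpos := support_nonempty_of_degree_ne_zero (μ := ν) (by omega)
  obtain ⟨i, hi⟩ := card_eq_one.1 (by omega : #ν.support = 1)
  rw [Finsupp.degree_apply, hi, sum_singleton] at hd
  have h2 := (mem_cubicIdeal.1 hν).2.2.1 i
  have h3 := card_le_card ((hB.mem_closure_iff_fundSupport_subset (he i) hLB).1 (hL i))
  omega

/-- All supports and exponents are at most two, so a cubic would be some `x_i² x_j`. But an
independent pair inside the closure of `L` spans both elements of `L`, and then no square is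
allowed. -/
lemma IsBase.degree_ne_three_of_forall_mem_closure (hB : M.IsBase B) (he : ∀ i, e i ∈ M.E)
    {L : Finset α} (hLB : L ⊆ B) (hc : #L = 2) (hL : ∀ i, e i ∈ M.closure L) {ν : ι →₀ ℕ}
    (hν : ν ∈ M.hIdeal B e) : ν.degree ≠ 3 := by
  intro hd
  have h1 := card_support_le_of_mem_hIdeal hν hL
  have hpos := support_nonempty_of_degree_ne_zero (μ := ν) (by omega)
  have hbd : ∀ i, ν i ≤ 2 := fun i => by
    have h2 := (mem_cubicIdeal.1 hν).2.2.1 i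
    have h3 := card_le_card ((hB.mem_closure_iff_fundSupport_subset (he i) hLB).1 (hL i))
    omega
  obtain h | h : #ν.support = 1 ∨ #ν.support = 2 := by omega
  · obtain ⟨i, hi⟩ := card_eq_one.1 h
    rw [Finsupp.degree_apply, hi, sum_singleton] at hd
    have := hbd i
    omega
  · obtain ⟨i, j, hij, hs⟩ := card_eq_two.1 h
    have hW : M.SquareRel B e i j ∨ M.SquareRel B e j i := by
      rw [Finsupp.degree_apply, hs, sum_pair hij] at hd
      have hi := hbd i
      have hj := hbd j
      obtain h2 | h2 : 2 ≤ ν i ∨ 2 ≤ ν j := by omega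
      · exact .inl ((mem_cubicIdeal.1 hν).2.2.2 i j hij h2 (by simp [hs]))
      · exact .inr ((mem_cubicIdeal.1 hν).2.2.2 j i hij.symm h2 (by simp [hs]))
    have hI : M.Indep {e i, e j} := by
      have := (mem_cubicIdeal.1 hν).2.1
      rwa [hs, coe_insert, coe_singleton, Set.image_pair] at this
    have hcl : M.closure L ⊆ M.closure {e i, e j} := by
      refine hI.closure_subset_closure_of_encard_le (by simp) ?_ ?_
      · exact Set.insert_subset (hL i) (Set.singleton_subset_iff.2 (hL j))
      · rw [Set.encard_pair (e.injective.ne hij), Set.encard_coe_eq_coe_finsetCard, hc]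
        rfl
    have hsub : L ⊆ M.closureTrace B {e i, e j} := fun b hb =>
      mem_closureTrace.2 ⟨hLB hb, hcl (M.mem_closure_of_mem' hb (hB.subset_ground (hLB hb)))⟩
    have := card_le_card hsub
    rw [SquareRel, SquareRel, Set.pair_comm (e j) (e i)] at hW
    omega

/-- Any `e j` outside the closure would extend `S` to a larger independent set, hence to a
squarefree multiple in the ideal. -/
lemma forall_mem_closure_of_not_lt [M.Loopless] (hB : M.IsBase B) (he : ∀ i, e i ∈ M.E)
    {S : Finset ι} (hc : #S ≤ 2) (hS : M.Indep (e '' S))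
    (hmax : ∀ ρ ∈ M.hIdeal B e, ¬ squarefreeMonomial S < ρ) (j : ι) :
    e j ∈ M.closure (e '' S) := by
  by_contra hj
  have hjS : j ∉ S := fun h => hj (M.mem_closure_of_mem' (Set.mem_image_of_mem _ h) (he j))
  refine hmax (squarefreeMonomial (insert j S)) (squarefreeMonomial_mem_cubicIdeal
    (fun i => hB.one_le_card_fundSupport (he i)) ?_ ?_) (lt_of_le_of_degree_lt ?_ ?_)
  · rw [coe_insert, Set.image_insert_eq, hS.insert_indep_iff]
    exact .inl ⟨he j, hj⟩
  · rw [card_insert_of_notMem hjS]; omega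
  · rw [squarefreeMonomial_insert hjS]; exact le_self_add
  · rw [degree_squarefreeMonomial, degree_squarefreeMonomial, card_insert_of_notMem hjS]; omega

lemma IsBase.exists_lt_of_degree_one [M.Loopless] (hB : M.IsBase B) (he : ∀ i, e i ∈ M.E)
    {μ ν : ι →₀ ℕ} (hμ1 : μ.degree = 1) (hν : ν ∈ M.hIdeal B e) (hd : ν.degree = 2) :
    ∃ ρ ∈ M.hIdeal B e, μ < ρ := by
  by_contra! hmax
  have hc := card_support_le_degree μ
  have hpos := support_nonempty_of_degree_ne_zero (μ := μ) (by omega)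
  have hsq := eq_squarefreeMonomial (μ := μ) (by omega)
  obtain ⟨i, hi⟩ := card_eq_one.1 (by omega : #μ.support = 1)
  rw [hi] at hsq
  subst hsq
  have hall := forall_mem_closure_of_not_lt hB he (by simp) (indep_image_singleton he i) hmax
  rw [coe_singleton, Set.image_singleton] at hall
  have hci : #(M.fundSupport B (e i)) = 1 := by
    by_contra h
    have := hB.one_le_card_fundSupport (he i)
    refine hmax (Finsupp.single i 2) (single_mem_cubicIdeal (indep_image_singleton he i)
      (by norm_num) (by norm_num) (by omega)) (lt_of_le_of_degree_lt ?_ ?_)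
    · rw [squarefreeMonomial_singleton]; exact Finsupp.single_mono (by norm_num)
    · rw [hμ1, Finsupp.degree_single]; norm_num
  refine hB.degree_ne_two_of_forall_mem_closure he fundSupport_subset hci (fun j => ?_) hν hd
  exact M.closure_subset_closure_of_subset_closure
    (Set.singleton_subset_iff.2 (hB.mem_closure_fundSupport (he i))) (hall j)

/-- If no larger member existed, two elements of `B` would span every `e j`: the fundamental support
of `e i` when `μ = x_i²`, the elements of `B` spanned by the pair when `μ = x_i x_j`. That excludes
`ν`. -/
lemma IsBase.exists_lt_of_degree_two [M.Loopless] (hB : M.IsBase B) (he : ∀ i, e i ∈ M.E)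
    {μ ν : ι →₀ ℕ} (hμ : μ ∈ M.hIdeal B e) (hμ2 : μ.degree = 2) (hν : ν ∈ M.hIdeal B e)
    (hd : ν.degree = 3) : ∃ ρ ∈ M.hIdeal B e, μ < ρ := by
  by_contra! hmax
  have hk : ∀ i, 1 ≤ #(M.fundSupport B (e i)) := fun i => hB.one_le_card_fundSupport (he i)
  have hμ' := mem_cubicIdeal.1 hμ
  have hc := card_support_le_degree μ
  have hpos := support_nonempty_of_degree_ne_zero (μ := μ) (by omega)
  obtain h1 | h2 : #μ.support = 1 ∨ #μ.support = 2 := by omega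
  · obtain ⟨i, hi⟩ := card_eq_one.1 h1
    obtain ⟨i, rfl⟩ : ∃ i, μ = Finsupp.single i 2 := by
      have h3 := Finsupp.support_subset_singleton.1 hi.subset
      refine ⟨i, ?_⟩
      rw [h3, Finsupp.degree_single] at hμ2
      rw [h3, hμ2]
    have hI := indep_image_singleton (M := M) he i
    have hci : #(M.fundSupport B (e i)) = 2 := by
      have h3 := hμ'.2.2.1 i
      rw [Finsupp.single_eq_same] at h3
      by_contra h
      refine hmax (Finsupp.single i 3) (single_mem_cubicIdeal hI le_rfl (by norm_num) (by omega))
        (lt_of_le_of_degree_lt (Finsupp.single_mono (by norm_num)) ?_)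
      rw [Finsupp.degree_single, Finsupp.degree_single]
      norm_num
    refine hB.degree_ne_three_of_forall_mem_closure he fundSupport_subset hci (fun j => ?_) hν hd
    by_contra hj
    have hicl := hB.mem_closure_fundSupport (he i)
    have hji : j ∉ ({i} : Finset ι) := by
      rw [mem_singleton]; rintro rfl; exact hj hicl
    -- The witness is `x_i² x_j`.
    refine hmax (squarefreeMonomial (insert j {i}) + Finsupp.single i 1)
      (squarefreeMonomial_add_single_mem_cubicIdeal hk ?_ ?_ (by simp) hci.ge ?_)
      (lt_of_le_of_degree_lt ?_ ?_)
    · rw [coe_insert, Set.image_insert_eq, hI.insert_indep_iff]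
      refine .inl ⟨he j, fun h => hj ?_⟩
      rw [coe_singleton, Set.image_singleton] at h
      exact M.closure_subset_closure_of_subset_closure (Set.singleton_subset_iff.2 hicl) h
    · rw [card_insert_of_notMem hji, card_singleton]
    · intro l hl hil
      rw [mem_insert, mem_singleton] at hl
      rw [hl.resolve_right hil.symm]
      exact hB.squareRel_of_notMem_closure he hci hj
    · rw [squarefreeMonomial_insert hji, squarefreeMonomial_singleton, add_right_comm,
        ← Finsupp.single_add]
      exact le_self_add
    · rw [map_add, degree_squarefreeMonomial, card_insert_of_notMem hji, Finsupp.degree_single,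
        Finsupp.degree_single, card_singleton]
      norm_num
  · obtain ⟨S, rfl⟩ : ∃ S, μ = squarefreeMonomial S :=
      ⟨_, eq_squarefreeMonomial (hμ2.trans h2.symm)⟩
    rw [support_squarefreeMonomial] at h2 hμ'
    have hS := hμ'.2.1
    have hall := forall_mem_closure_of_not_lt hB he h2.le hS hmax
    have hsum := hB.card_squareRel_add_card_closureTrace he h2 hS
    have hemp : #{i ∈ S | SquareAllowed (M.SquareRel B e) S i} = 0 := by
      rw [card_eq_zero, filter_eq_empty_iff]
      intro i hi hW
      obtain ⟨l, hl⟩ : (S.erase i).Nonempty := by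
        rw [← card_pos, card_erase_of_mem hi]; omega
      refine hmax _ (squarefreeMonomial_add_single_mem_cubicIdeal hk hS h2 hi
        (hW l (mem_of_mem_erase hl) (ne_of_mem_erase hl).symm).1 hW)
        (lt_of_le_of_degree_lt le_self_add ?_)
      rw [map_add, Finsupp.degree_single]
      omega
    rw [hemp, zero_add] at hsum
    obtain ⟨i, j, hij, rfl⟩ := card_eq_two.1 h2
    rw [coe_insert, coe_singleton, Set.image_pair] at hall hsum
    refine hB.degree_ne_three_of_forall_mem_closure he closureTrace_subset
      hsum (fun l => ?_) hν hd
    exact hB.closure_pair_subset Subset.rfl hsum (hall l)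

lemma IsBase.isPureFamily_hIdeal [M.Loopless] (hB : M.IsBase B) (he : ∀ i, e i ∈ M.E) :
    IsPureFamily (M.hIdeal B e) := by
  refine isOrderIdeal_hIdeal.isPureFamily fun μ hμ ν hν hd => ?_
  have h3 := (mem_cubicIdeal.1 hν).1
  obtain h | h | h : μ.degree = 0 ∨ μ.degree = 1 ∨ μ.degree = 2 := by omega
  · refine ⟨ν, hν, lt_of_le_of_degree_lt ?_ (by omega)⟩
    rw [(Finsupp.degree_eq_zero_iff μ).1 h]
    exact zero_le
  · exact hB.exists_lt_of_degree_one he h hν (by omega)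
  · exact hB.exists_lt_of_degree_two he hμ h hν (by omega)

end Matroid

end

noncomputable section

/-! ### Counting subsets, and binomial identities. -/

section Counting

open Finset

lemma Finset.sum_powersetCard_union {α N : Type*} [DecidableEq α] [AddCommMonoid N]
    {s t : Finset α} (hst : Disjoint s t) (n : ℕ) (g : Finset α → N) :
    ∑ S ∈ powersetCard n (s ∪ t), g S =
      ∑ p ∈ antidiagonal n, ∑ S ∈ powersetCard p.1 s, ∑ T ∈ powersetCard p.2 t, g (S ∪ T) := by
  simp_rw [sum_sigma']
  have hs : ∀ S T : Finset α, S ⊆ s → T ⊆ t → (S ∪ T) ∩ s = S := by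
    intro S T hS hT
    rw [union_inter_distrib_right, inter_eq_left.2 hS,
      disjoint_iff_inter_eq_empty.1 (hst.symm.mono_left hT), union_empty]
  have ht : ∀ S T : Finset α, S ⊆ s → T ⊆ t → (S ∪ T) ∩ t = T := by
    intro S T hS hT
    rw [union_inter_distrib_right, inter_eq_left.2 hT,
      disjoint_iff_inter_eq_empty.1 (hst.mono_left hS), empty_union]
  refine sum_bij' (fun U _ => ⟨(#(U ∩ s), #(U ∩ t)), U ∩ s, U ∩ t⟩) (fun x _ => x.2.1 ∪ x.2.2)
    ?_ ?_ ?_ ?_ ?_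
  · intro U hU
    rw [mem_powersetCard] at hU
    simp only [mem_sigma, HasAntidiagonal.mem_antidiagonal, mem_powersetCard, inter_subset_right, and_true]
    rw [← card_union_of_disjoint (hst.mono inter_subset_right inter_subset_right),
      ← inter_union_distrib_left, inter_eq_left.2 hU.1, hU.2]
  · rintro ⟨⟨a, b⟩, S, T⟩ h
    simp only [mem_sigma, HasAntidiagonal.mem_antidiagonal, mem_powersetCard] at h ⊢
    obtain ⟨rfl, ⟨hS, rfl⟩, hT, rfl⟩ := h
    exact ⟨union_subset_union hS hT, card_union_of_disjoint (hst.mono hS hT)⟩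
  · intro U hU
    rw [mem_powersetCard] at hU
    rw [← inter_union_distrib_left, inter_eq_left.2 hU.1]
  · rintro ⟨⟨a, b⟩, S, T⟩ h
    simp only [mem_sigma, HasAntidiagonal.mem_antidiagonal, mem_powersetCard] at h
    obtain ⟨rfl, ⟨hS, rfl⟩, hT, rfl⟩ := h
    simp only [hs S T hS hT, ht S T hS hT]
  · intro U hU
    rw [mem_powersetCard] at hU
    rw [← inter_union_distrib_left, inter_eq_left.2 hU.1]

lemma Finset.card_filter_superset_powersetCard {α : Type*} [DecidableEq α] {s K : Finset α}
    (hK : K ⊆ s) (n : ℕ) :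
    #{T ∈ powersetCard (#K + n) s | K ⊆ T} = (#s - #K).choose n := by
  rw [← card_sdiff_of_subset hK, ← card_powersetCard]
  refine card_bij' (fun T _ => T \ K) (fun T _ => K ∪ T) ?_ ?_ ?_ ?_
  · intro T hT
    simp only [mem_filter, mem_powersetCard] at hT ⊢
    refine ⟨sdiff_subset_sdiff hT.1.1 Subset.rfl, ?_⟩
    rw [card_sdiff_of_subset hT.2]; omega
  · intro T hT
    simp only [mem_filter, mem_powersetCard] at hT ⊢
    refine ⟨⟨union_subset hK (hT.1.trans sdiff_subset), ?_⟩, subset_union_left⟩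
    rw [card_union_of_disjoint (disjoint_sdiff.mono_right hT.1), hT.2]
  · intro T hT
    simp only [mem_filter] at hT
    exact union_sdiff_of_subset hT.2
  · intro T hT
    simp only [mem_powersetCard] at hT
    exact union_sdiff_cancel_left (disjoint_sdiff.mono_right hT.1)

lemma Polynomial.coeff_one_sub_X_pow (n k : ℕ) :
    ((1 - X : ℤ[X]) ^ n).coeff k = (-1) ^ k * n.choose k := by
  have h : (1 - X : ℤ[X]) ^ n = ((1 + X) ^ n).comp (C (-1) * X) := by
    simp [sub_eq_add_neg]
  rw [h, comp_C_mul_X_coeff, coeff_one_add_X_pow, mul_comm]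

lemma Nat.two_mul_cast_choose_two (n : ℕ) : 2 * (n.choose 2 : ℤ) = n * (n - 1) := by
  induction n with
  | zero => simp
  | succ n ih =>
    rw [Nat.choose_succ_succ' n 1, Nat.choose_one_right]
    push_cast
    linarith

end Counting

/-! ### The `h`-numbers, computed by splitting independent sets along the base. -/

namespace Matroid

open Finset Classical

variable {α : Type*} {M : Matroid α}

lemma hNumber_eq_sum {j : ℕ} (hj : j ≤ M.natRank) :
    M.hNumber j = ∑ i ∈ range (j + 1),
      (M.numIndep i : ℤ) * ((-1) ^ (j - i) * (M.natRank - i).choose (j - i)) := by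
  rw [hNumber, hPoly, finsetSum_coeff]
  symm
  -- Terms with `i > j` are divisible by `X ^ i` and contribute nothing to the coefficient.
  refine sum_subset_zero_on_sdiff (range_subset_range.2 (by omega)) ?_ ?_
  · intro i hi
    rw [mem_sdiff, mem_range, mem_range] at hi
    rw [mul_assoc, coeff_C_mul, coeff_X_pow_mul', if_neg (by omega), mul_zero]
  · intro i hi
    rw [mem_range] at hi
    rw [mul_assoc, coeff_C_mul, coeff_X_pow_mul', if_pos (by omega), coeff_one_sub_X_pow]

lemma numIndep_zero (M : Matroid α) : M.numIndep 0 = 1 := by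
  rw [numIndep, Set.ncard_eq_one]
  refine ⟨∅, ?_⟩
  ext A
  simp only [Nat.cast_zero, Set.encard_eq_zero, Set.mem_ofPred_eq, Set.mem_singleton_iff]
  exact ⟨fun h => h.2, fun h => ⟨h ▸ M.empty_indep, h⟩⟩

lemma hNumber_zero (M : Matroid α) : M.hNumber 0 = 1 := by
  rw [hNumber_eq_sum (Nat.zero_le _)]
  simp [numIndep_zero]

lemma numIndep_eq_card {E : Finset α} (hE : (E : Set α) = M.E) (n : ℕ) :
    M.numIndep n = #((powersetCard n E).filter fun S : Finset α => M.Indep S) := by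
  rw [numIndep, ← Set.ncard_coe_finset, ← Set.ncard_image_of_injective _ coe_injective]
  congr 1
  ext A
  simp only [Set.mem_ofPred_eq, coe_filter, mem_powersetCard, Set.mem_image]
  constructor
  · rintro ⟨hA, hc⟩
    have hfin : A.Finite := E.finite_toSet.subset (hE ▸ hA.subset_ground)
    lift A to Finset α using hfin
    rw [Set.encard_coe_eq_coe_finsetCard] at hc
    exact ⟨A, ⟨⟨coe_subset.1 (hE ▸ hA.subset_ground), by exact_mod_cast hc⟩, hA⟩, rfl⟩
  · rintro ⟨S, ⟨⟨-, hc⟩, hS⟩, rfl⟩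
    exact ⟨hS, by rw [Set.encard_coe_eq_coe_finsetCard, hc]⟩

variable {B : Finset α} {ι : Type*} [Fintype ι] {e : ι ↪ α}

/-- The sets of `j` indices whose image under `e` is independent. -/
def indepFamily (M : Matroid α) (e : ι ↪ α) (j : ℕ) : Finset (Finset ι) :=
  (powersetCard j univ).filter fun S : Finset ι => M.Indep (e '' S)

/-- The number of independent sets with `i` elements in `B` and `j` elements in the range of
`e`. -/
def numIndepSplit (M : Matroid α) (B : Finset α) (e : ι ↪ α) (j i : ℕ) : ℕ :=
  ∑ S ∈ powersetCard j (univ : Finset ι), #((powersetCard i B).filter fun T : Finset α => M.Indep (e '' S ∪ T))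

lemma numIndep_eq_sum_antidiagonal (hE : (B : Set α) ∪ Set.range e = M.E)
    (hd : Disjoint (B : Set α) (Set.range e)) (n : ℕ) :
    M.numIndep n = ∑ p ∈ antidiagonal n, M.numIndepSplit B e p.1 p.2 := by
  have hE' : ((univ.map e ∪ B : Finset α) : Set α) = M.E := by
    rw [coe_union, coe_map, coe_univ, Set.image_univ, Set.union_comm, hE]
  have hd' : Disjoint (univ.map e) B := by
    rw [← disjoint_coe, coe_map, coe_univ, Set.image_univ]
    exact hd.symm
  rw [numIndep_eq_card hE', card_filter, sum_powersetCard_union hd']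
  refine sum_congr rfl fun p _ => ?_
  rw [powersetCard_map, sum_map, numIndepSplit]
  refine sum_congr rfl fun S _ => ?_
  rw [card_filter]
  simp

lemma numIndepSplit_zero_left (hB : M.Indep B) (i : ℕ) :
    M.numIndepSplit B e 0 i = (#B).choose i := by
  rw [numIndepSplit, powersetCard_zero, sum_singleton, filter_true_of_mem, card_powersetCard]
  intro T hT
  rw [coe_empty, Set.image_empty, Set.empty_union]
  exact hB.subset (coe_subset.2 (mem_powersetCard.1 hT).1)

lemma numIndepSplit_zero_right (j : ℕ) :
    M.numIndepSplit B e j 0 = #(M.indepFamily e j) := by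
  rw [numIndepSplit, indepFamily, card_filter]
  refine sum_congr rfl fun S _ => ?_
  rw [powersetCard_zero, card_filter, sum_singleton, coe_empty, Set.union_empty]

/-- For independent `S`, adding `b ∈ B` destroys independence exactly when `b` is spanned by `S`. -/
lemma IsBase.numIndepSplit_one_right (hB : M.IsBase B) (hd : Disjoint (B : Set α) (Set.range e))
    (j : ℕ) :
    M.numIndepSplit B e j 1 +
      ∑ S ∈ M.indepFamily e j, #(M.closureTrace B (e '' S)) =
      #(M.indepFamily e j) * #B := by
  rw [numIndepSplit, indepFamily, sum_filter, card_filter, sum_mul, ← sum_add_distrib]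
  refine sum_congr rfl fun S _ => ?_
  rw [powersetCard_one, filter_map, card_map]
  split_ifs with hS
  · have h : #(M.closureTrace B (e '' S)) + #{b ∈ B | b ∉ M.closure (e '' S)} = #B :=
      card_filter_add_card_filter_not _
    rw [one_mul, ← h, add_comm]
    congr 2
    refine filter_congr fun b hb => ?_
    have hbS : b ∉ e '' S := fun h =>
      Set.disjoint_left.1 hd hb (Set.image_subset_range _ _ h)
    simp [hS.insert_indep_iff_of_notMem hbS, hB.subset_ground hb]
  · rw [zero_mul, add_zero, card_eq_zero, filter_eq_empty_iff]
    intro b _ h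
    exact hS (h.subset Set.subset_union_left)

/-- For `T ⊆ B`, adding `e x` destroys independence exactly when `T` contains the fundamental
support of `e x`. -/
lemma IsBase.numIndepSplit_one_left (hB : M.IsBase B) (he : ∀ i, e i ∈ M.E)
    (hd : Disjoint (B : Set α) (Set.range e)) (i : ℕ) :
    M.numIndepSplit B e 1 i + ∑ x, #{T ∈ powersetCard i B | M.fundSupport B (e x) ⊆ T} =
      Fintype.card ι * (#B).choose i := by
  rw [numIndepSplit, powersetCard_one, sum_map, ← sum_add_distrib, ← card_univ,
    ← smul_eq_mul, ← sum_const]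
  refine sum_congr rfl fun x _ => ?_
  rw [← card_powersetCard, add_comm, ← card_filter_add_card_filter_not (s := powersetCard i B)
    (p := fun T => M.fundSupport B (e x) ⊆ T)]
  congr 2
  refine filter_congr fun T hT => ?_
  have hTB := (mem_powersetCard.1 hT).1
  have hxT : e x ∉ (T : Set α) := fun h => Set.disjoint_left.1 hd (hTB h) ⟨x, rfl⟩
  rw [← hB.mem_closure_iff_fundSupport_subset (he x) hTB]
  simp [(hB.indep.subset (coe_subset.2 hTB)).insert_indep_iff_of_notMem hxT, he x]

lemma card_filter_fundSupport_subset (x : α) (i : ℕ) :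
    #{T ∈ powersetCard i B | M.fundSupport B x ⊆ T} =
      if #(M.fundSupport B x) ≤ i then
        (#B - #(M.fundSupport B x)).choose (i - #(M.fundSupport B x)) else 0 := by
  split_ifs with h
  · obtain ⟨n, rfl⟩ := Nat.exists_eq_add_of_le h
    rw [card_filter_superset_powersetCard fundSupport_subset, Nat.add_sub_cancel_left]
  · rw [card_eq_zero, filter_eq_empty_iff]
    intro T hT hsub
    have := card_le_card hsub
    rw [(mem_powersetCard.1 hT).2] at this
    omega

variable [M.Loopless]

lemma IsBase.numIndepSplit_one_one (hB : M.IsBase B) (he : ∀ i, e i ∈ M.E)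
    (hd : Disjoint (B : Set α) (Set.range e)) :
    M.numIndepSplit B e 1 1 + #{x | #(M.fundSupport B (e x)) = 1} = Fintype.card ι * #B := by
  have h := hB.numIndepSplit_one_left he hd 1
  rw [Nat.choose_one_right] at h
  rw [← h, card_filter]
  congr 1
  refine sum_congr rfl fun x _ => ?_
  rw [card_filter_fundSupport_subset]
  have := hB.one_le_card_fundSupport (he x)
  split_ifs with h1 h2 h2
  · rw [h1]; simp
  · omega
  · omega
  · rfl

/-- A support of size one lies in `#B - 1` pairs of `B`, one of size two in a single pair, and a
larger one in none. -/
lemma IsBase.numIndepSplit_one_two (hB : M.IsBase B) (he : ∀ i, e i ∈ M.E)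
    (hd : Disjoint (B : Set α) (Set.range e)) :
    M.numIndepSplit B e 1 2 + (#{x | #(M.fundSupport B (e x)) = 1} * (#B - 1) +
      #{x | #(M.fundSupport B (e x)) = 2}) = Fintype.card ι * (#B).choose 2 := by
  rw [← hB.numIndepSplit_one_left he hd 2, card_filter, card_filter, sum_mul, ← sum_add_distrib]
  congr 1
  refine sum_congr rfl fun x _ => ?_
  rw [card_filter_fundSupport_subset]
  have := hB.one_le_card_fundSupport (he x)
  obtain h | h | h : #(M.fundSupport B (e x)) = 1 ∨ #(M.fundSupport B (e x)) = 2 ∨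
    3 ≤ #(M.fundSupport B (e x)) := by omega
  · simp [h]
  · simp [h]
  · rw [if_neg (by omega), if_neg (by omega), if_neg (by omega)]; simp

variable [LinearOrder ι]

lemma IsBase.card_hIdeal_filter_degree (hB : M.IsBase B) (hr : M.natRank = #B) (h3 : 3 ≤ #B)
    (he : ∀ i, e i ∈ M.E) (hE : (B : Set α) ∪ Set.range e = M.E)
    (hd : Disjoint (B : Set α) (Set.range e)) {j : ℕ} (hj : j ≤ 3) :
    M.hNumber j = #{μ ∈ M.hIdeal B e | μ.degree = j} := by
  have hk : ∀ i, 1 ≤ #(M.fundSupport B (e i)) := fun i => hB.one_le_card_fundSupport (he i)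
  have hI := indep_image_singleton (M := M) he
  have f0 := M.numIndep_zero
  have f1 : M.numIndep 1 = #B + Fintype.card ι := by
    rw [numIndep_eq_sum_antidiagonal hE hd]
    simp only [Nat.sum_antidiagonal_eq_sum_range_succ_mk, sum_range_succ, range_zero, sum_empty]
    rw [numIndepSplit_zero_left hB.indep, numIndepSplit_zero_right, indepFamily, filter_true_of_mem]
    · simp
    · intro S hS
      obtain ⟨i, rfl⟩ := card_eq_one.1 (mem_powersetCard.1 hS).2
      exact hI i
  have f2 : M.numIndep 2 = (#B).choose 2 + M.numIndepSplit B e 1 1 +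
      #(M.indepFamily e 2) := by
    rw [numIndep_eq_sum_antidiagonal hE hd]
    simp only [Nat.sum_antidiagonal_eq_sum_range_succ_mk, sum_range_succ, range_zero, sum_empty]
    rw [numIndepSplit_zero_left hB.indep, numIndepSplit_zero_right]
    simp
  have f3 : M.numIndep 3 = (#B).choose 3 + M.numIndepSplit B e 1 2 + M.numIndepSplit B e 2 1 +
      #(M.indepFamily e 3) := by
    rw [numIndep_eq_sum_antidiagonal hE hd]
    simp only [Nat.sum_antidiagonal_eq_sum_range_succ_mk, sum_range_succ, range_zero, sum_empty]
    rw [numIndepSplit_zero_left hB.indep, numIndepSplit_zero_right]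
    simp
  have s11 := hB.numIndepSplit_one_one he hd
  have s12 := hB.numIndepSplit_one_two he hd
  have s21 := hB.numIndepSplit_one_right hd 2
  have ht : (∑ S ∈ M.indepFamily e 2,
      #{i ∈ S | SquareAllowed (M.SquareRel B e) S i}) +
      ∑ S ∈ M.indepFamily e 2, #(M.closureTrace B (e '' S)) =
      #(M.indepFamily e 2) * 2 := by
    rw [← sum_add_distrib, ← smul_eq_mul, ← sum_const]
    refine sum_congr rfl fun S hS => ?_
    rw [indepFamily, mem_filter, mem_powersetCard] at hS
    exact hB.card_squareRel_add_card_closureTrace he hS.1.2 hS.2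
  have k1 : #{x | #(M.fundSupport B (e x)) = 1} + #{x | 2 ≤ #(M.fundSupport B (e x))} =
      Fintype.card ι := by
    rw [← card_univ, ← card_filter_add_card_filter_not (s := (univ : Finset ι))
      (p := fun x => #(M.fundSupport B (e x)) = 1)]
    congr 2
    exact filter_congr fun x _ => by have := hk x; omega
  have k2 : #{x | #(M.fundSupport B (e x)) = 2} + #{x | 3 ≤ #(M.fundSupport B (e x))} =
      #{x | 2 ≤ #(M.fundSupport B (e x))} := by
    rw [← card_union_of_disjoint (disjoint_filter.2 fun x _ h1 h2 => by omega), ← filter_or]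
    congr 1
    exact filter_congr fun x _ => by omega
  rw [hNumber_eq_sum (by omega), hr]
  interval_cases j
  · rw [hIdeal, card_degree_zero_cubicIdeal (by simp) hk]
    simp [f0]
  · rw [hIdeal, card_degree_one_cubicIdeal hI hk]
    simp [sum_range_succ, f0, f1]
  · rw [hIdeal, card_degree_two_cubicIdeal hI hk]
    simp only [sum_range_succ, range_zero, sum_empty, f0, f1, f2]
    rw [show #((powersetCard 2 (univ : Finset ι)).filter fun S : Finset ι => M.Indep (e '' S)) =
      #(M.indepFamily e 2) from rfl]
    have hc := Nat.two_mul_cast_choose_two #B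
    generalize #{x | 2 ≤ #(M.fundSupport B (e x))} = a2 at *
    generalize #{x | #(M.fundSupport B (e x)) = 1} = a1 at *
    generalize #B = d at *
    generalize Fintype.card ι = m at *
    zify at s11 k1
    simp [Nat.cast_sub (show 1 ≤ d by omega)]
    linarith
  · rw [hIdeal, card_degree_three_cubicIdeal hI hk fun i j h => h.1]
    simp only [sum_range_succ, range_zero, sum_empty, f0, f1, f2, f3]
    rw [show #((powersetCard 3 (univ : Finset ι)).filter fun S : Finset ι => M.Indep (e '' S)) =
      #(M.indepFamily e 3) from rfl,
      show (powersetCard 2 (univ : Finset ι)).filter (fun S : Finset ι => M.Indep (e '' S)) =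
      M.indepFamily e 2 from rfl]
    have hc := Nat.two_mul_cast_choose_two #B
    have hc' := Nat.two_mul_cast_choose_two (#B - 1)
    generalize #{x | 3 ≤ #(M.fundSupport B (e x))} = a3 at *
    generalize #{x | 2 ≤ #(M.fundSupport B (e x))} = a2 at *
    generalize #{x | #(M.fundSupport B (e x)) = 1} = a1 at *
    generalize #{x | #(M.fundSupport B (e x)) = 2} = b2 at *
    generalize #B = d at *
    generalize Fintype.card ι = m at *
    zify [show 1 ≤ d by omega] at s11 s12 s21 ht k1 k2 hc'
    simp [Nat.cast_sub (show 2 ≤ d by omega)]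
    -- Doubling clears the binomials `choose 2` through `hc` and `hc'`; the `choose 3` terms cancel
    -- between the contributions of the third and zeroth counts.
    refine mul_left_cancel₀ (two_ne_zero' ℤ) ?_
    linear_combination 2 * s12 + 2 * s21 - 2 * ((d : ℤ) - 2) * s11 - 2 * ht - 2 * k1 - 2 * k2 +
      ((d : ℤ) + m) * hc' + ((m : ℤ) - d + 2) * hc

/-- A finite-rank loopless matroid of rank at least three has a pure order ideal of monomials of
degree at most three counted by its first four `h`-numbers. -/
theorem exists_isPureFamily_hNumber {α : Type*} (M : Matroid α) [M.Finite] [M.Loopless]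
    (hr : 3 ≤ M.natRank) : ∃ (n : ℕ) (O : Finset (Fin n →₀ ℕ)),
      IsOrderIdeal O ∧ IsPureFamily O ∧ (∀ μ ∈ O, μ.degree ≤ 3) ∧
        ∀ j ≤ 3, M.hNumber j = ((O.filter fun μ => μ.degree = j).card : ℤ) := by
  obtain ⟨B', hB'⟩ := M.exists_isBase
  obtain ⟨B, rfl⟩ := (M.ground_finite.subset hB'.subset_ground).exists_finset_coe
  obtain ⟨X, hX⟩ := (M.ground_finite.subset (Set.sdiff_subset (t := (B : Set α)))).exists_finset_coe
  -- The variables enumerate the complement of the base; indexing by `Fin` also supplies the linear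
  -- order used for ties.
  let e : Fin #X ↪ α := X.equivFin.symm.toEmbedding.trans (Function.Embedding.subtype _)
  have hrange : Set.range e = M.E \ B := by
    rw [← hX]
    ext x
    constructor
    · rintro ⟨i, rfl⟩
      exact (X.equivFin.symm i).2
    · exact fun hx => ⟨X.equivFin ⟨x, hx⟩, by simp [e]⟩
  have he : ∀ i, e i ∈ M.E := fun i =>
    (hrange ▸ Set.mem_range_self i : e i ∈ M.E \ (B : Set α)).1
  have hcard : M.natRank = #B := by
    rw [natRank, ← hB'.encard_eq_eRank, Set.encard_coe_eq_coe_finsetCard, ENat.toNat_natCast]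
  refine ⟨#X, M.hIdeal B e, isOrderIdeal_hIdeal, hB'.isPureFamily_hIdeal he,
    fun μ hμ => (mem_cubicIdeal.1 hμ).1, fun j hj => ?_⟩
  convert hB'.card_hIdeal_filter_degree hcard (hcard ▸ hr) he ?_ ?_ hj
  · rw [hrange, Set.union_sdiff_cancel hB'.subset_ground]
  · rw [hrange]
    exact Set.disjoint_sdiff_right

end Matroid

end
theorem mainTheorem3 {α : Type*} (M : Matroid α) [M.Finite] [M.Loopless] (d : ℕ)
    (hrank : M.eRank = (d : ℕ∞)) (hd : 3 ≤ d) :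
    IsPureOSequence ![1, M.hNumber 1, M.hNumber 2, M.hNumber 3] ∧
      (d = 3 → IsPureOSequence M.hVector) := by
  have hr : M.natRank = d := by rw [Matroid.natRank, hrank, ENat.toNat_natCast]
  obtain ⟨n, O, h1, h2, h3, h4⟩ := M.exists_isPureFamily_hNumber (hr ▸ hd)
  refine ⟨⟨n, O, h1, h2, h3, fun i => ?_⟩, fun hd3 => ⟨n, O, h1, h2, ?_, fun i => ?_⟩⟩
  · rw [← h4 i (by omega)]
    fin_cases i
    · exact M.hNumber_zero.symm
    all_goals rfl
  · rw [hr, hd3]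
    exact h3
  · exact h4 i (by omega)
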